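/- Let $\ell \ge 2$ and $t \ge 2$ be integers. The theta graph $\Theta_\ell^t$ is the graph consisting of $t$ paths with $\ell$ edges each between the same two distinct vertices, any two of which share no vertex other than these two end vertices. There exists a constant $C = C(\ell,t) > 0$, depending only on $\ell$ and $t$, such that for all integers $s \ge 2$ and $n \ge 1$, every simple graph $G$ on $n$ vertices that does not contain $K_{s,s}$ as a (not necessarily induced) subgraph and has at least \[ C \cdot (\ell t)^{20s} \cdot n^{1+\frac{1}{\ell}} \] edges contains $\Theta_\ell^t$ as an induced subgraph. -/

import Mathlib

/-- Vertices of the theta graph: `Sum.inl false` and `Sum.inl true` are the common first and last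
vertex of the `t` paths, and `Sum.inr (i, j)` is the `(j + 1)`-st of the `ℓ - 1` internal vertices
of the `i`-th path, counted from the first vertex. -/
abbrev ThetaVertex (ℓ t : ℕ) : Type := Bool ⊕ (Fin t × Fin (ℓ - 1))

/-- `ThetaStep ℓ t x y`: some path, traversed from its first to its last vertex, visits `y`
immediately after `x`. -/
def ThetaStep (ℓ t : ℕ) : ThetaVertex ℓ t → ThetaVertex ℓ t → Prop
  | Sum.inl false, Sum.inr (_, j) => (j : ℕ) = 0
  | Sum.inr (i, j), Sum.inr (i', j') => i = i' ∧ (j : ℕ) + 1 = (j' : ℕ)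
  | Sum.inr (_, j), Sum.inl true => (j : ℕ) + 2 = ℓ
  | _, _ => False

/-- The theta graph `Θ_ℓ^t` (for `ℓ ≥ 2`): `t` paths with `ℓ` edges each between the same two
vertices, pairwise sharing only these two vertices. -/
def thetaGraph (ℓ t : ℕ) : SimpleGraph (ThetaVertex ℓ t) :=
  SimpleGraph.fromRel (ThetaStep ℓ t)

/-!
Deleting vertices of small degree gives an induced subgraph with all degrees at least
`δ = (ℓt)^(20s+16) n^(1/ℓ)`. Let `M` be its normalized adjacency matrix, weight a walk by the
product of the entries of `M` along its steps, and consider pairs of walks of length `ℓ` with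
common ends, that is, closed walks of length `2ℓ`. Their total weight is `tr M^(2ℓ)`, which is at
least `1` because `1` is an eigenvalue of `M`.

Two vertices of a closed walk cut it into walks of lengths `a` and `b` with `a + b = 2ℓ`, so the
weight of the pairs in which they coincide or are adjacent is the sum of `(M^a) z y * (M^b) z y`
over equal or adjacent `z`, `y`. Moving the ends along the closed walk makes the two vertices
internal to different walks of the pair. For fixed ends, a weighted Kővári–Sós–Turán argument
bounds this sum by a small fraction of the total weight, unless a single vertex carries much of
the weight of the walks. The exceptional ends account for little weight: that is a bound on the
sum of `(M^(2i)) z z * (M^(2j)) z z` over `z` with `i + j = ℓ`, which by Chebyshev's inequality is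
at most the sum of `(M^2) z z * (M^(2ℓ-2)) z z`, hence at most `δ⁻¹ * tr M^(2ℓ-2)`, and
`tr M^(2ℓ-2)` is at most `2 n^(1/ℓ) * tr M^(2ℓ)`.

So most pairs of walks consist of induced paths whose interiors are disjoint and not joined by an
edge. Between suitable ends, `t` walks that pairwise have this property can be chosen greedily,
and they form an induced theta graph.
-/

section SpectralMoments

open Finset Matrix

variable {V : Type*} [Fintype V] [DecidableEq V] {M : Matrix V V ℝ}

theorem isHermitian_pow_eq_mul_diagonal_mul (hM : M.IsHermitian) (j : ℕ) :
    M ^ j = hM.eigenvectorUnitary.1 * diagonal (fun k => hM.eigenvalues k ^ j) *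
      star hM.eigenvectorUnitary.1 := by
  conv_lhs => rw [hM.spectral_theorem, ← map_pow, Unitary.conjStarAlgAut_apply, diagonal_pow]
  rfl

theorem isHermitian_pow_apply_self (hM : M.IsHermitian) (j : ℕ) (z : V) :
    (M ^ j) z z = ∑ k, hM.eigenvalues k ^ j * hM.eigenvectorUnitary.1 z k ^ 2 := by
  rw [isHermitian_pow_eq_mul_diagonal_mul hM, mul_apply]
  refine sum_congr rfl fun k _ => ?_
  rw [mul_diagonal, star_apply, star_trivial]
  ring

theorem isHermitian_trace_pow (hM : M.IsHermitian) (j : ℕ) :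
    (M ^ j).trace = ∑ k, hM.eigenvalues k ^ j := by
  rw [isHermitian_pow_eq_mul_diagonal_mul hM, trace_mul_comm, ← mul_assoc,
    Unitary.coe_star_mul_self, one_mul, trace_diagonal]

theorem isHermitian_pow_apply_comm (hM : M.IsHermitian) (j : ℕ) (x y : V) :
    (M ^ j) x y = (M ^ j) y x := by
  rw [← (hM.pow j).apply x y, star_trivial]

theorem isHermitian_pow_add_apply (hM : M.IsHermitian) (i j : ℕ) (x y : V) :
    (M ^ (i + j)) x y = ∑ u, (M ^ i) u x * (M ^ j) u y := by
  rw [pow_add, mul_apply]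
  exact sum_congr rfl fun u _ => by rw [isHermitian_pow_apply_comm hM]

theorem isHermitian_pow_two_mul_apply_self (hM : M.IsHermitian) (j : ℕ) (z : V) :
    (M ^ (2 * j)) z z = ∑ u, (M ^ j) u z ^ 2 := by
  simp only [two_mul, isHermitian_pow_add_apply hM, sq]

theorem isHermitian_trace_pow_two_mul (hM : M.IsHermitian) (j : ℕ) :
    (M ^ (2 * j)).trace = ∑ u, ∑ v, (M ^ j) u v ^ 2 := by
  rw [sum_comm]
  exact sum_congr rfl fun z _ => isHermitian_pow_two_mul_apply_self hM j z

theorem pow_mul_pow_add_pow_mul_pow_le {x y : ℝ} (hx : 0 ≤ x) (hy : 0 ≤ y) (a b : ℕ) :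
    x ^ (a + 1) * y ^ (b + 1) + y ^ (a + 1) * x ^ (b + 1)
      ≤ x * y ^ (a + b + 1) + y * x ^ (a + b + 1) := by
  have same_sign : 0 ≤ (x ^ a - y ^ a) * (x ^ b - y ^ b) := by
    rcases le_total x y with h | h
    · exact mul_nonneg_of_nonpos_of_nonpos (sub_nonpos.2 (pow_le_pow_left₀ hx h a))
        (sub_nonpos.2 (pow_le_pow_left₀ hx h b))
    · exact mul_nonneg (sub_nonneg.2 (pow_le_pow_left₀ hy h a))
        (sub_nonneg.2 (pow_le_pow_left₀ hy h b))
  calc x ^ (a + 1) * y ^ (b + 1) + y ^ (a + 1) * x ^ (b + 1)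
      ≤ x ^ (a + 1) * y ^ (b + 1) + y ^ (a + 1) * x ^ (b + 1)
        + x * y * ((x ^ a - y ^ a) * (x ^ b - y ^ b)) :=
        le_add_of_nonneg_right (mul_nonneg (mul_nonneg hx hy) same_sign)
    _ = x * y ^ (a + b + 1) + y * x ^ (a + b + 1) := by ring

theorem two_mul_sum_mul_sum_eq {K : Type*} [Fintype K] (f g p : K → ℝ) :
    2 * ((∑ k, f k * p k) * ∑ k, g k * p k)
      = ∑ k, ∑ l, (f k * g l + f l * g k) * (p k * p l) := by
  have expand (f g : K → ℝ) :
      (∑ k, f k * p k) * ∑ k, g k * p k = ∑ k, ∑ l, f k * g l * (p k * p l) := by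
    simp only [sum_mul_sum, mul_mul_mul_comm]
  simp only [add_mul, sum_add_distrib]
  rw [← expand f g, sum_comm]
  simp only [mul_comm (p _) (p _), ← expand f g, two_mul]

/-- Chebyshev's correlation inequality, comparing the extreme exponents with the middle ones. -/
theorem sum_pow_mul_sum_pow_le {K : Type*} [Fintype K] {x p : K → ℝ} (hx : ∀ k, 0 ≤ x k)
    (hp : ∀ k, 0 ≤ p k) (a b : ℕ) :
    (∑ k, x k ^ (a + 1) * p k) * (∑ k, x k ^ (b + 1) * p k)
      ≤ (∑ k, x k * p k) * (∑ k, x k ^ (a + b + 1) * p k) := by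
  refine le_of_mul_le_mul_left ?_ (zero_lt_two (α := ℝ))
  simp only [two_mul_sum_mul_sum_eq]
  exact sum_le_sum fun k _ => sum_le_sum fun l _ => mul_le_mul_of_nonneg_right
    (pow_mul_pow_add_pow_mul_pow_le (hx k) (hx l) a b) (mul_nonneg (hp k) (hp l))

theorem isHermitian_pow_apply_self_mul_le (hM : M.IsHermitian) (a b : ℕ) (z : V) :
    (M ^ (2 * (a + 1))) z z * (M ^ (2 * (b + 1))) z z
      ≤ (M ^ 2) z z * (M ^ (2 * (a + b + 1))) z z := by
  simp only [isHermitian_pow_apply_self hM, pow_mul]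
  exact sum_pow_mul_sum_pow_le (fun k => sq_nonneg _) (fun k => sq_nonneg _) a b

theorem pow_le_mul_pow_succ_add_inv {x N : ℝ} (hx : 0 ≤ x) (hN : 0 < N) (m : ℕ) :
    x ^ m ≤ N * x ^ (m + 1) + (N ^ m)⁻¹ := by
  rcases le_total 1 (N * x) with h | h
  · calc x ^ m ≤ N * x * x ^ m := le_mul_of_one_le_left (pow_nonneg hx m) h
      _ = N * x ^ (m + 1) := by ring
      _ ≤ N * x ^ (m + 1) + (N ^ m)⁻¹ := le_add_of_nonneg_right (by positivity)
  · calc x ^ m ≤ N⁻¹ ^ m := pow_le_pow_left₀ hx ((le_inv_mul_iff₀ hN).2 h |>.trans_eq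
          (mul_one _)) m
      _ = (N ^ m)⁻¹ := inv_pow _ _
      _ ≤ N * x ^ (m + 1) + (N ^ m)⁻¹ := le_add_of_nonneg_left (by positivity)

theorem isHermitian_trace_pow_le (hM : M.IsHermitian) {m : ℕ}
    (h1 : 1 ≤ (M ^ (2 * (m + 1))).trace) {N : ℝ} (hN : 0 < N)
    (hNV : N ^ (m + 1) = Fintype.card V) :
    (M ^ (2 * m)).trace ≤ 2 * N * (M ^ (2 * (m + 1))).trace := by
  have hcard : Fintype.card V * (N ^ m)⁻¹ = N := by
    rw [← hNV, pow_succ']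
    field_simp
  calc (M ^ (2 * m)).trace = ∑ k, (hM.eigenvalues k ^ 2) ^ m := by
        rw [isHermitian_trace_pow hM]
        simp only [pow_mul]
    _ ≤ ∑ k, (N * (hM.eigenvalues k ^ 2) ^ (m + 1) + (N ^ m)⁻¹) :=
        sum_le_sum fun k _ => pow_le_mul_pow_succ_add_inv (sq_nonneg _) hN m
    _ = N * (M ^ (2 * (m + 1))).trace + N := by
        rw [sum_add_distrib, ← mul_sum, sum_const, card_univ, nsmul_eq_mul, hcard,
          isHermitian_trace_pow hM]
        simp only [pow_mul]
    _ ≤ 2 * N * (M ^ (2 * (m + 1))).trace := by nlinarith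

theorem isHermitian_one_le_trace_pow (hM : M.IsHermitian) {v : V → ℝ} (hv : v ≠ 0)
    (hMv : M *ᵥ v = v) (m : ℕ) : 1 ≤ (M ^ (2 * m)).trace := by
  have h_one_mem : (1 : ℝ) ∈ spectrum ℝ M := by
    rw [← spectrum_toLin']
    refine (Module.End.hasEigenvalue_of_hasEigenvector (x := v) ⟨?_, hv⟩).mem_spectrum
    rw [Module.End.mem_eigenspace_iff, toLin'_apply, hMv, one_smul]
  rw [hM.spectrum_real_eq_range_eigenvalues] at h_one_mem
  obtain ⟨k, hk⟩ := h_one_mem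
  calc 1 = hM.eigenvalues k ^ (2 * m) := by rw [hk, one_pow]
    _ ≤ ∑ k, hM.eigenvalues k ^ (2 * m) :=
        single_le_sum (f := fun k => hM.eigenvalues k ^ (2 * m))
          (fun _ _ => (even_two_mul m).pow_nonneg _) (mem_univ k)
    _ = (M ^ (2 * m)).trace := (isHermitian_trace_pow hM _).symm

end SpectralMoments

section NormalizedAdjacency

open Finset Matrix

variable {V : Type*} [Fintype V] (G : SimpleGraph V) [DecidableRel G.Adj]

/-- The symmetrically normalized adjacency matrix `D^(-1/2) A D^(-1/2)`, where `A` is the adjacency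
matrix and `D` the diagonal matrix of the degrees. It supplies the weights of the walks. -/
noncomputable def normalizedAdjMatrix : Matrix V V ℝ :=
  .of fun x y => G.adjMatrix ℝ x y * ((√(G.degree x))⁻¹ * (√(G.degree y))⁻¹)

theorem normalizedAdjMatrix_apply (x y : V) : normalizedAdjMatrix G x y =
    G.adjMatrix ℝ x y * ((√(G.degree x))⁻¹ * (√(G.degree y))⁻¹) := rfl

theorem normalizedAdjMatrix_nonneg (x y : V) : 0 ≤ normalizedAdjMatrix G x y := by
  rw [normalizedAdjMatrix_apply, SimpleGraph.adjMatrix_apply]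
  split_ifs <;> positivity

variable {G} in
theorem adj_of_normalizedAdjMatrix_ne_zero {x y : V} (h : normalizedAdjMatrix G x y ≠ 0) :
    G.Adj x y := by
  contrapose! h
  rw [normalizedAdjMatrix_apply, SimpleGraph.adjMatrix_apply, if_neg h, zero_mul]

theorem isHermitian_normalizedAdjMatrix : (normalizedAdjMatrix G).IsHermitian := by
  refine IsHermitian.ext fun x y => ?_
  rw [star_trivial, normalizedAdjMatrix_apply, normalizedAdjMatrix_apply,
    (G.isSymm_adjMatrix (α := ℝ)).apply, mul_comm (√(G.degree y))⁻¹]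

theorem sum_adjMatrix_apply (x : V) : ∑ y, G.adjMatrix ℝ x y = G.degree x := by
  simpa [mulVec, dotProduct] using G.adjMatrix_mulVec_const_apply (a := (1 : ℝ)) (v := x)

theorem normalizedAdjMatrix_mulVec_sqrt_degree (hd : ∀ x, 0 < G.degree x) :
    (normalizedAdjMatrix G *ᵥ fun x => √(G.degree x)) = fun x => √(G.degree x) := by
  have sqrt_ne_zero (x) : √(G.degree x) ≠ 0 := (Real.sqrt_pos.2 (Nat.cast_pos.2 (hd x))).ne'
  funext x
  calc ∑ y, normalizedAdjMatrix G x y * √(G.degree y)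
      = ∑ y, G.adjMatrix ℝ x y * (√(G.degree x))⁻¹ := sum_congr rfl fun y _ => by
        rw [normalizedAdjMatrix_apply, mul_assoc, inv_mul_cancel_right₀ (sqrt_ne_zero y)]
    _ = √(G.degree x) := by
        rw [← sum_mul, sum_adjMatrix_apply, ← div_eq_mul_inv, Real.div_sqrt]

variable [DecidableEq V]

theorem one_le_trace_normalizedAdjMatrix_pow [Nonempty V] (hd : ∀ x, 0 < G.degree x) (m : ℕ) :
    1 ≤ (normalizedAdjMatrix G ^ (2 * m)).trace := by
  refine isHermitian_one_le_trace_pow (isHermitian_normalizedAdjMatrix G) (fun h => ?_)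
    (normalizedAdjMatrix_mulVec_sqrt_degree G hd) m
  have x := Classical.arbitrary V
  exact (Real.sqrt_pos.2 (Nat.cast_pos.2 (hd x))).ne' (congrFun h x)

variable {G} {δ : ℝ} (hδ : 0 < δ) (hd : ∀ x, δ ≤ G.degree x)
include hδ hd

theorem normalizedAdjMatrix_sq_apply_self_le (z : V) : (normalizedAdjMatrix G ^ 2) z z ≤ δ⁻¹ := by
  have hpos (x) : (0 : ℝ) < G.degree x := hδ.trans_le (hd x)
  rw [← mul_one 2, isHermitian_pow_two_mul_apply_self (isHermitian_normalizedAdjMatrix G), pow_one]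
  calc ∑ u, normalizedAdjMatrix G u z ^ 2
      ≤ ∑ u, G.adjMatrix ℝ z u * (δ⁻¹ * (G.degree z : ℝ)⁻¹) := sum_le_sum fun u _ => by
        rw [normalizedAdjMatrix_apply, (G.isSymm_adjMatrix (α := ℝ)).apply z u,
          SimpleGraph.adjMatrix_apply]
        split_ifs
        · rw [one_mul, one_mul, mul_pow, inv_pow, inv_pow, Real.sq_sqrt (hpos u).le,
            Real.sq_sqrt (hpos z).le]
          exact mul_le_mul_of_nonneg_right (inv_anti₀ hδ (hd u)) (inv_nonneg.2 (hpos z).le)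
        · simp
    _ = δ⁻¹ := by
        rw [← sum_mul, sum_adjMatrix_apply, mul_left_comm, mul_inv_cancel₀ (hpos z).ne', mul_one]

/-- The left-hand side is the weight of the closed walks of length `2 (i + j)` consisting of a
closed walk of length `2 i` and one of length `2 j` through the same vertex. -/
theorem sum_normalizedAdjMatrix_pow_mul_pow_le [Nonempty V] {i j : ℕ} (hi : i ≠ 0) (hj : j ≠ 0)
    {N : ℝ} (hN : 0 < N) (hNV : N ^ (i + j) = Fintype.card V) :
    ∑ z, (normalizedAdjMatrix G ^ (2 * i)) z z * (normalizedAdjMatrix G ^ (2 * j)) z z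
      ≤ 2 * N / δ * (normalizedAdjMatrix G ^ (2 * (i + j))).trace := by
  obtain ⟨a, rfl⟩ := Nat.exists_eq_succ_of_ne_zero hi
  obtain ⟨b, rfl⟩ := Nat.exists_eq_succ_of_ne_zero hj
  set M := normalizedAdjMatrix G
  have hM : M.IsHermitian := isHermitian_normalizedAdjMatrix G
  have hexp : a.succ + b.succ = a + b + 1 + 1 := by omega
  rw [hexp] at hNV ⊢
  calc ∑ z, (M ^ (2 * (a + 1))) z z * (M ^ (2 * (b + 1))) z z
      ≤ ∑ z, (M ^ 2) z z * (M ^ (2 * (a + b + 1))) z z :=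
        sum_le_sum fun z _ => isHermitian_pow_apply_self_mul_le hM a b z
    _ ≤ ∑ z, δ⁻¹ * (M ^ (2 * (a + b + 1))) z z :=
        sum_le_sum fun z _ => mul_le_mul_of_nonneg_right
          (normalizedAdjMatrix_sq_apply_self_le hδ hd z)
          (pow_apply_nonneg (normalizedAdjMatrix_nonneg G) _ _ _)
    _ = δ⁻¹ * (M ^ (2 * (a + b + 1))).trace := (mul_sum ..).symm
    _ ≤ δ⁻¹ * (2 * N * (M ^ (2 * (a + b + 1 + 1))).trace) :=
        mul_le_mul_of_nonneg_left (isHermitian_trace_pow_le hM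
          (one_le_trace_normalizedAdjMatrix_pow G
            (fun x => Nat.cast_pos.1 (hδ.trans_le (hd x))) _) hN hNV) (inv_nonneg.2 hδ.le)
    _ = 2 * N / δ * (M ^ (2 * (a + b + 1 + 1))).trace := by ring

end NormalizedAdjacency

section WeightedKovariSosTuran

open Finset

section Relation

variable {A B : Type*} {r : A → B → Prop} [DecidableRel r] {α : A → ℝ} {β : B → ℝ}

theorem sum_sum_filter_mul_comm (r : A → B → Prop) [DecidableRel r] (S : Finset A) (Y : Finset B)
    (α : A → ℝ) (β : B → ℝ) :
    ∑ z ∈ S, α z * ∑ y ∈ Y with r z y, β y = ∑ y ∈ Y, β y * ∑ z ∈ S with r z y, α z := by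
  simp only [sum_filter, mul_sum, mul_ite, mul_zero]
  rw [sum_comm]
  simp only [mul_comm]

theorem exists_mul_sum_le_sum_filter {S : Finset A} (hS : S.Nonempty) {Y : Finset B}
    (hα : ∀ z, 0 ≤ α z) (hβ : ∀ y, 0 ≤ β y) {w θ : ℝ} (hw : 0 < w) (hSw : ∑ z ∈ S, α z ≤ w)
    (hY : ∀ y ∈ Y, θ * w ≤ ∑ z ∈ S with r z y, α z) :
    ∃ z ∈ S, θ * ∑ y ∈ Y, β y ≤ ∑ y ∈ Y with r z y, β y := by
  obtain ⟨z₀, hz₀, hmax⟩ := exists_max_image S (fun z => ∑ y ∈ Y with r z y, β y) hS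
  refine ⟨z₀, hz₀, le_of_mul_le_mul_left ?_ hw⟩
  calc w * (θ * ∑ y ∈ Y, β y) = ∑ y ∈ Y, β y * (θ * w) := by rw [← sum_mul]; ring
    _ ≤ ∑ y ∈ Y, β y * ∑ z ∈ S with r z y, α z :=
        sum_le_sum fun y hy => mul_le_mul_of_nonneg_left (hY y hy) (hβ y)
    _ = ∑ z ∈ S, α z * ∑ y ∈ Y with r z y, β y := (sum_sum_filter_mul_comm r S Y α β).symm
    _ ≤ ∑ z ∈ S, α z * ∑ y ∈ Y with r z₀ y, β y :=
        sum_le_sum fun z hz => mul_le_mul_of_nonneg_left (hmax z hz) (hα z)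
    _ ≤ w * ∑ y ∈ Y with r z₀ y, β y := by
        rw [← sum_mul]
        exact mul_le_mul_of_nonneg_right hSw (sum_nonneg fun y _ => hβ y)

theorem sum_filter_compl_ge [Fintype A] [DecidableEq A] (hα : ∀ z, 0 ≤ α z) {C : ℝ}
    (hαC : ∀ z, α z ≤ C) (Z : Finset A) (y : B) :
    ∑ z with r z y, α z - #Z * C ≤ ∑ z ∈ Zᶜ with r z y, α z := by
  have inside : ∑ z ∈ Z with r z y, α z ≤ #Z * C := by
    rw [← nsmul_eq_mul]
    exact (sum_le_sum_of_subset_of_nonneg (filter_subset _ _) fun z _ _ => hα z).trans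
      (sum_le_card_nsmul _ _ _ fun z _ => hαC z)
  have split : ∑ z ∈ Z with r z y, α z + ∑ z ∈ Zᶜ with r z y, α z = ∑ z with r z y, α z := by
    simp only [sum_filter]
    exact sum_add_sum_compl Z _
  linarith

/-- Since no single point carries more than `c * w`, the points chosen so far carry at most `θ * w`,
so averaging over the remaining points finds the next one. -/
theorem exists_card_eq_pow_mul_sum_le [Fintype A] (hα : ∀ z, 0 ≤ α z) (hβ : ∀ y, 0 ≤ β y)
    {w c θ : ℝ} (hw : 0 < w) (hαw : ∑ z, α z = w) (hc : 0 ≤ c) (hαc : ∀ z, α z ≤ c * w)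
    (hθ : 0 < θ) {Y : Finset B} (hβY : 0 < ∑ y ∈ Y, β y)
    (hY : ∀ y ∈ Y, 2 * θ * w ≤ ∑ z with r z y, α z) {k : ℕ} (hk : k * c ≤ θ) :
    ∃ Z : Finset A, #Z = k ∧ ∃ Y' ⊆ Y, (∀ z ∈ Z, ∀ y ∈ Y', r z y) ∧
      θ ^ k * ∑ y ∈ Y, β y ≤ ∑ y ∈ Y', β y := by
  classical
  induction k with
  | zero => exact ⟨∅, rfl, Y, subset_rfl, by simp, by simp⟩
  | succ k ih =>
    have hkc : k * c ≤ θ := by push_cast at hk; linarith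
    obtain ⟨Z, hZ, Y', hY', hZY, hβY'⟩ := ih hkc
    have outside (y) (hy : y ∈ Y') : θ * w ≤ ∑ z ∈ Zᶜ with r z y, α z := by
      have := sum_filter_compl_ge (r := r) hα hαc Z y
      rw [hZ] at this
      nlinarith [hY y (hY' hy)]
    obtain ⟨y₀, hy₀⟩ : Y'.Nonempty :=
      nonempty_of_sum_ne_zero ((mul_pos (pow_pos hθ k) hβY).trans_le hβY').ne'
    have hZc : Zᶜ.Nonempty := (nonempty_of_sum_ne_zero
      ((mul_pos hθ hw).trans_le (outside y₀ hy₀)).ne').mono (filter_subset _ _)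
    obtain ⟨z, hz, hzY⟩ := exists_mul_sum_le_sum_filter hZc hα hβ hw
      ((sum_le_univ_sum_of_nonneg hα).trans hαw.le) outside
    refine ⟨insert z Z, by rw [card_insert_of_notMem (mem_compl.1 hz), hZ], Y'.filter (r z),
      (filter_subset _ _).trans hY', ?_, ?_⟩
    · intro x hx y hy
      obtain ⟨hyY', hzy⟩ := mem_filter.1 hy
      rcases mem_insert.1 hx with rfl | hxZ
      exacts [hzy, hZY x hxZ y hyY']
    · calc θ ^ (k + 1) * ∑ y ∈ Y, β y = θ * (θ ^ k * ∑ y ∈ Y, β y) := by ring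
        _ ≤ θ * ∑ y ∈ Y', β y := mul_le_mul_of_nonneg_left hβY' hθ.le
        _ ≤ ∑ y ∈ Y' with r z y, β y := hzY

theorem mul_lt_two_mul_sum_filter [Fintype B] {f β : B → ℝ} (hβ : ∀ y, 0 ≤ β y) {w b η : ℝ}
    (hfw : ∀ y, f y ≤ w) (hβb : ∑ y, β y = b) (hη : 0 ≤ η) (hw : 0 < w)
    (h : η * (w * b) < ∑ y, β y * f y) :
    η * b < 2 * ∑ y with η / 2 * w ≤ f y, β y := by
  have hpt (y) : β y * f y ≤ w * (if η / 2 * w ≤ f y then β y else 0) + η / 2 * w * β y := by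
    split_ifs with hy
    · have := mul_le_mul_of_nonneg_left (hfw y) (hβ y)
      have := mul_nonneg (mul_nonneg hη hw.le) (hβ y)
      linarith
    · have := mul_le_mul_of_nonneg_left (not_le.1 hy).le (hβ y)
      linarith
  have hsum := sum_le_sum fun y (_ : y ∈ univ) => hpt y
  rw [sum_add_distrib, ← mul_sum, ← mul_sum, hβb, ← sum_filter] at hsum
  refine lt_of_mul_lt_mul_left (a := w) ?_ hw.le
  linarith

/-- A weighted Kővári–Sós–Turán theorem: `hr` says that `r` contains no large complete bipartite
relation. -/
theorem sum_mul_sum_filter_le [Fintype A] [Fintype B] {s m : ℕ}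
    (hr : ∀ (Z : Finset A) (Y : Finset B), #Z = s → (∀ z ∈ Z, ∀ y ∈ Y, r z y) → #Y ≤ m)
    (hα : ∀ z, 0 ≤ α z) (hβ : ∀ y, 0 ≤ β y) {w b c η : ℝ} (hαw : ∑ z, α z = w)
    (hβb : ∑ y, β y = b) (hc : 0 ≤ c) (hαc : ∀ z, α z ≤ c * w) (hβc : ∀ y, β y ≤ c * b)
    (hη : 0 < η) (hsc : 4 * (s * c) ≤ η) (hmc : 2 * (m * c) ≤ (η / 4) ^ s * η) :
    ∑ z, α z * ∑ y with r z y, β y ≤ η * (w * b) := by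
  by_contra! h
  rw [sum_sum_filter_mul_comm] at h
  have hb : 0 ≤ b := hβb ▸ sum_nonneg fun y _ => hβ y
  have hfw (y) : ∑ z with r z y, α z ≤ w := (sum_le_univ_sum_of_nonneg hα).trans hαw.le
  have hw : 0 < w := by
    have hw0 : 0 ≤ w := hαw ▸ sum_nonneg fun z _ => hα z
    refine hw0.lt_of_ne' fun hw0 => h.not_ge ?_
    rw [hw0, zero_mul, mul_zero]
    exact sum_nonpos fun y _ => mul_nonpos_of_nonneg_of_nonpos (hβ y) (hw0 ▸ hfw y)
  have hrich := mul_lt_two_mul_sum_filter hβ hfw hβb hη.le hw h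
  set Y₀ := univ.filter fun y => η / 2 * w ≤ ∑ z with r z y, α z
  have hηb : 0 ≤ η * b := mul_nonneg hη.le hb
  obtain ⟨Z, hZ, Y, -, hZY, hβY⟩ := exists_card_eq_pow_mul_sum_le (θ := η / 4) (Y := Y₀)
    (k := s) hα hβ hw hαw hc hαc (by positivity) (by linarith)
    (fun y hy => (by linarith : 2 * (η / 4) * w ≤ η / 2 * w).trans (mem_filter.1 hy).2)
    (by linarith)
  have hupper : ∑ y ∈ Y, β y ≤ m * (c * b) := by
    refine (sum_le_card_nsmul _ _ _ fun y _ => hβc y).trans ?_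
    rw [nsmul_eq_mul]
    exact mul_le_mul_of_nonneg_right (Nat.cast_le.2 (hr Z Y hZ hZY)) (mul_nonneg hc hb)
  have hpow : 0 < (η / 4) ^ s := by positivity
  have hlower := mul_lt_mul_of_pos_left hrich hpow
  have := mul_le_mul_of_nonneg_right hmc hb
  linarith

theorem sq_le_sum_sq_div_sq_of_lt [Fintype A] {w c : ℝ} (hw : 0 ≤ w) (hc : 0 < c) {z : A}
    (hz : c * w < α z) : w ^ 2 ≤ (∑ z, α z ^ 2) / c ^ 2 := by
  rw [le_div_iff₀ (by positivity)]
  calc w ^ 2 * c ^ 2 = (c * w) ^ 2 := by ring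
    _ ≤ α z ^ 2 := pow_le_pow_left₀ (by positivity) hz.le 2
    _ ≤ ∑ z, α z ^ 2 := single_le_sum (fun z _ => sq_nonneg (α z)) (mem_univ z)

theorem sum_mul_sum_filter_le_add [Fintype A] [Fintype B] {s m : ℕ}
    (hr : ∀ (Z : Finset A) (Y : Finset B), #Z = s → (∀ z ∈ Z, ∀ y ∈ Y, r z y) → #Y ≤ m)
    (hα : ∀ z, 0 ≤ α z) (hβ : ∀ y, 0 ≤ β y) {w c η : ℝ} (hαw : ∑ z, α z = w)
    (hβw : ∑ y, β y = w) (hc : 0 < c) (hη : 0 < η) (hsc : 4 * (s * c) ≤ η)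
    (hmc : 2 * (m * c) ≤ (η / 4) ^ s * η) :
    ∑ z, α z * ∑ y with r z y, β y
      ≤ η * w ^ 2 + (∑ z, α z ^ 2 + ∑ y, β y ^ 2) / c ^ 2 := by
  have hw : 0 ≤ w := hαw ▸ sum_nonneg fun z _ => hα z
  have trivial_bound : ∑ z, α z * ∑ y with r z y, β y ≤ w ^ 2 := by
    calc ∑ z, α z * ∑ y with r z y, β y ≤ ∑ z, α z * w := sum_le_sum fun z _ =>
          mul_le_mul_of_nonneg_left ((sum_le_univ_sum_of_nonneg hβ).trans hβw.le) (hα z)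
      _ = w ^ 2 := by rw [← sum_mul, hαw, sq]
  have hα2 : 0 ≤ (∑ z, α z ^ 2) / c ^ 2 := by positivity
  have hβ2 : 0 ≤ (∑ y, β y ^ 2) / c ^ 2 := by positivity
  have hηw : 0 ≤ η * w ^ 2 := by positivity
  rw [add_div]
  by_cases hαc : ∀ z, α z ≤ c * w
  · by_cases hβc : ∀ y, β y ≤ c * w
    · have := sum_mul_sum_filter_le hr hα hβ hαw hβw hc.le hαc hβc hη hsc hmc
      rw [← sq] at this
      linarith
    · push Not at hβc
      have := sq_le_sum_sq_div_sq_of_lt hw hc hβc.choose_spec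
      linarith
  · push Not at hαc
    have := sq_le_sum_sq_div_sq_of_lt hw hc hαc.choose_spec
    linarith

end Relation

variable {V : Type*} {G : SimpleGraph V}

/-- The closed neighbourhood relation. Vertices that ought to be distinct and non-adjacent in an
induced copy of the theta graph are those for which it fails. -/
def EqOrAdj (G : SimpleGraph V) (x y : V) : Prop := x = y ∨ G.Adj x y

theorem EqOrAdj.symm {x y : V} (h : EqOrAdj G x y) : EqOrAdj G y x :=
  Or.imp Eq.symm SimpleGraph.Adj.symm h

theorem card_le_of_completeBipartiteGraph_free {s : ℕ}
    (hG : (completeBipartiteGraph (Fin s) (Fin s)).Free G) {Z Y : Finset V} (hZ : #Z = s)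
    (hZY : ∀ z ∈ Z, ∀ y ∈ Y, EqOrAdj G z y) : #Y ≤ 2 * s := by
  classical
  by_contra! hY
  obtain ⟨W, hWY, hW⟩ : ∃ W ⊆ Y \ Z, #W = s :=
    exists_subset_card_eq (by have := le_card_sdiff Z Y; omega)
  refine hG (SimpleGraph.completeBipartiteGraph_isContained_iff.2
    ⟨Z, W, by simpa using hZ, by simpa using hW, fun z hz w hw => ?_⟩)
  obtain ⟨hwY, hwZ⟩ := mem_sdiff.1 (hWY hw)
  exact (hZY z hz w hwY).resolve_left fun h => hwZ (h ▸ hz)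

end WeightedKovariSosTuran

section GreedySelection

open Finset

variable {X : Type*} [Fintype X] {R : X → X → Prop} [DecidableRel R] {W : X → ℝ}

theorem exists_pos_weight_not_conflict (hW : ∀ p, 0 ≤ W p) {w : ℝ} (hWw : ∑ p, W p = w) {ε : ℝ}
    (hR : 2 * ∑ p, W p * ∑ q with R p q, W q < ε * w) (hε : 0 < ε) {k : ℕ} (f : Fin k → X)
    (hf : ∀ a, ∑ q with R (f a) q, W q < ε) (hk : 2 * (k * ε) ≤ w) :
    ∃ p, 0 < W p ∧ ∑ q with R p q, W q < ε ∧ ∀ a, ¬R (f a) p := by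
  by_contra! hno
  have hpt (p) : ε * W p ≤ W p * ∑ q with R p q, W q +
      ε * ∑ a, if R (f a) p then W p else 0 := by
    have hnonneg (a) : 0 ≤ if R (f a) p then W p else 0 := by split_ifs <;> simp [hW]
    by_cases hp : W p ≤ 0 ∨ ε ≤ ∑ q with R p q, W q
    · refine le_add_of_le_of_nonneg ?_ (mul_nonneg hε.le (sum_nonneg fun a _ => hnonneg a))
      rcases hp with hp | hp
      · simp [le_antisymm hp (hW p)]
      · rw [mul_comm]
        exact mul_le_mul_of_nonneg_left hp (hW p)
    · push Not at hp
      obtain ⟨a, ha⟩ := hno p hp.1 hp.2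
      refine le_add_of_nonneg_of_le (mul_nonneg (hW p) (sum_nonneg fun q _ => hW q))
        (mul_le_mul_of_nonneg_left ?_ hε.le)
      exact (if_pos ha).symm.le.trans (single_le_sum (fun a _ => hnonneg a) (mem_univ a))
  have hsum := sum_le_sum fun p (_ : p ∈ univ) => hpt p
  rw [sum_add_distrib, ← mul_sum, ← mul_sum, sum_comm, hWw] at hsum
  simp only [← sum_filter] at hsum
  have hchosen : ∑ a, ∑ q with R (f a) q, W q ≤ k * ε := by
    simpa using sum_le_sum fun a (_ : a ∈ univ) => (hf a).le
  have := mul_le_mul_of_nonneg_left (hchosen.trans (by linarith : k * ε ≤ w / 2)) hε.le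
  linarith

theorem exists_pairwise_not_conflict [Std.Symm R] (hW : ∀ p, 0 ≤ W p) {w : ℝ}
    (hWw : ∑ p, W p = w) {t : ℕ} (ht : 0 < t)
    (hconflict : 4 * t * ∑ p, W p * ∑ q with R p q, W q < w ^ 2) :
    ∃ f : Fin t → X, (∀ a, 0 < W (f a)) ∧ Pairwise fun a b => ¬R (f a) (f b) := by
  have ht' : (0 : ℝ) < t := Nat.cast_pos.2 ht
  have hw : 0 < w := by
    have hnonneg : 0 ≤ ∑ p, W p * ∑ q with R p q, W q :=
      sum_nonneg fun p _ => mul_nonneg (hW p) (sum_nonneg fun q _ => hW q)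
    exact (hWw ▸ sum_nonneg fun p _ => hW p : 0 ≤ w).lt_of_ne'
      (pow_ne_zero_iff two_ne_zero |>.1 (lt_of_le_of_lt (by positivity) hconflict).ne')
  obtain ⟨ε, htε⟩ : ∃ ε, 2 * (t * ε) = w := ⟨w / (2 * t), by field_simp⟩
  have hε : 0 < ε := by
    rw [← htε] at hw
    exact pos_of_mul_pos_right (pos_of_mul_pos_right hw zero_le_two) ht'.le
  have hRε : 2 * ∑ p, W p * ∑ q with R p q, W q < ε * w :=
    lt_of_mul_lt_mul_left (a := 2 * (t : ℝ)) (by linear_combination hconflict - w * htε)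
      (by positivity)
  suffices ∀ k ≤ t, ∃ f : Fin k → X, (∀ a, 0 < W (f a) ∧ ∑ q with R (f a) q, W q < ε) ∧
      Pairwise fun a b => ¬R (f a) (f b) by
    obtain ⟨f, hf, hfR⟩ := this t le_rfl
    exact ⟨f, fun a => (hf a).1, hfR⟩
  intro k
  induction k with
  | zero => exact fun _ => ⟨Fin.elim0, fun a => a.elim0, fun a => a.elim0⟩
  | succ k ih =>
    intro hk
    obtain ⟨f, hf, hfR⟩ := ih (by omega)
    have hkε : 2 * (k * ε) ≤ w := by
      rw [← htε]
      have : (k : ℝ) ≤ t := Nat.cast_le.2 (by omega)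
      gcongr
    obtain ⟨p, hWp, hpε, hfp⟩ :=
      exists_pos_weight_not_conflict hW hWw hRε hε f (fun a => (hf a).2) hkε
    refine ⟨Fin.snoc f p, fun a => ?_, fun a b hab => ?_⟩
    · cases a using Fin.lastCases
      · simpa using ⟨hWp, hpε⟩
      · simpa using hf _
    · cases a using Fin.lastCases <;> cases b using Fin.lastCases
      · exact absurd rfl hab
      · simpa using fun h => hfp _ (symm_of R h)
      · simpa using hfp _
      · simpa using hfR (ne_of_apply_ne _ hab)

end GreedySelection

section WalkWeight

open Finset Matrix

variable {V K : Type*} [DecidableEq V] [CommSemiring K]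

/-- The weight of a sequence `p` of `n + 1` vertices regarded as a walk from `u` to `v`: the product
of the entries of `M` along the steps of `p`, or `0` if `p` does not start at `u` or does not end
at `v`. -/
def walkWeight (M : Matrix V V K) (n : ℕ) (u v : V) (p : Fin (n + 1) → V) : K :=
  if p 0 = u ∧ p (Fin.last n) = v then ∏ i : Fin n, M (p i.castSucc) (p i.succ) else 0

theorem walkWeight_nonneg {M : Matrix V V ℝ} (hM : ∀ x y, 0 ≤ M x y) (n : ℕ) (u v : V)
    (p : Fin (n + 1) → V) : 0 ≤ walkWeight M n u v p := by
  unfold walkWeight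
  split_ifs
  · exact prod_nonneg fun i _ => hM _ _
  · exact le_rfl

variable [Fintype V] (M : Matrix V V K)

theorem sum_walkWeight_zero (u v : V) (F : (Fin 1 → V) → K) :
    ∑ p, walkWeight M 0 u v p * F p = (1 : Matrix V V K) u v * F fun _ => u := by
  rw [← (Equiv.funUnique (Fin 1) V).symm.sum_comp]
  change ∑ y, (if y = u ∧ y = v then _ else (0 : K)) * F (fun _ => y) = _
  simp [one_apply, ite_and]

theorem walkWeight_succ_cons (n : ℕ) (u v x : V) (p : Fin (n + 1) → V) :
    walkWeight M (n + 1) u v (Fin.cons x p : Fin (n + 2) → V)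
      = if x = u then ∑ y, M u y * walkWeight M n y v p else 0 := by
  rw [sum_eq_single (p 0) (fun y _ hy => by rw [walkWeight, if_neg fun h => hy h.1.symm, mul_zero])
    (fun h => absurd (mem_univ _) h)]
  unfold walkWeight
  rw [Fin.prod_univ_succ, ← Fin.succ_last]
  simp only [Fin.cons_zero, Fin.cons_succ, Fin.castSucc_zero, Fin.castSucc_succ, true_and]
  split_ifs <;> simp_all

theorem sum_walkWeight_succ (n : ℕ) (u v : V) (F : (Fin (n + 2) → V) → K) :
    ∑ p, walkWeight M (n + 1) u v p * F p
      = ∑ y, M u y * ∑ p, walkWeight M n y v p * F (Fin.cons u p) := by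
  rw [← (Fin.consEquiv fun _ : Fin (n + 2) => V).sum_comp, Fintype.sum_prod_type, sum_eq_single u]
  · simp only [Fin.consEquiv, Equiv.coe_fn_mk, walkWeight_succ_cons, if_true, sum_mul, mul_sum]
    rw [sum_comm]
    simp only [mul_assoc]
  · intro x _ hx
    simp [Fin.consEquiv, walkWeight_succ_cons, hx]
  · simp

theorem sum_walkWeight (n : ℕ) (u v : V) : ∑ p, walkWeight M n u v p = (M ^ n) u v := by
  induction n generalizing u with
  | zero => simpa using sum_walkWeight_zero M u v fun _ => 1
  | succ n ih =>
    rw [pow_succ', mul_apply]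
    simpa only [mul_one, ih] using sum_walkWeight_succ M n u v fun _ => 1

theorem sum_walkWeight_mul_apply (n : ℕ) (u v : V) (i : Fin (n + 1)) (F : V → K) :
    ∑ p, walkWeight M n u v p * F (p i)
      = ∑ y, F y * ((M ^ (i : ℕ)) u y * (M ^ (n - i)) y v) := by
  induction n generalizing u with
  | zero =>
    rw [sum_walkWeight_zero M u v fun p => F (p i)]
    obtain rfl | huv := eq_or_ne u v <;> simp [one_apply, *]
  | succ n ih =>
    rw [sum_walkWeight_succ M n u v fun p => F (p i)]
    cases i using Fin.cases with
    | zero =>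
      simp only [Fin.cons_zero, ← sum_mul, sum_walkWeight, ← mul_assoc]
      rw [← mul_apply, ← pow_succ']
      simp [one_apply, mul_comm]
    | succ i =>
      simp only [Fin.cons_succ, ih, mul_sum]
      rw [sum_comm]
      refine sum_congr rfl fun y _ => ?_
      rw [Fin.val_succ, pow_succ', mul_apply, sum_mul, mul_sum, Nat.add_sub_add_right]
      exact sum_congr rfl fun x _ => by ring

theorem sum_walkWeight_mul_apply_zero (n : ℕ) (u v : V) (j : Fin (n + 1)) (F : V → V → K) :
    ∑ p, walkWeight M n u v p * F (p 0) (p j)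
      = ∑ p, walkWeight M n u v p * F u (p j) := by
  refine sum_congr rfl fun p _ => ?_
  by_cases hp : p 0 = u
  · rw [hp]
  · rw [walkWeight, if_neg fun h => hp h.1, zero_mul, zero_mul]

theorem sum_walkWeight_mul_apply_apply (n : ℕ) (u v : V) {i j : Fin (n + 1)} (hij : i ≤ j)
    (F : V → V → K) :
    ∑ p, walkWeight M n u v p * F (p i) (p j)
      = ∑ y, ∑ z, F y z *
          ((M ^ (i : ℕ)) u y * (M ^ (j - i : ℕ)) y z * (M ^ (n - j)) z v) := by
  induction n generalizing u with
  | zero =>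
    rw [sum_walkWeight_zero M u v fun p => F (p i) (p j)]
    obtain rfl | huv := eq_or_ne u v <;> simp [one_apply, *]
  | succ n ih =>
    cases i using Fin.cases with
    | zero =>
      rw [sum_walkWeight_mul_apply_zero, sum_walkWeight_mul_apply]
      simp [one_apply]
    | succ i =>
      obtain ⟨j, rfl⟩ := Fin.exists_succ_eq.2 ((Fin.succ_pos i).trans_le hij).ne'
      rw [sum_walkWeight_succ M n u v fun p => F (p i.succ) (p j.succ)]
      simp only [Fin.cons_succ, ih _ (Fin.succ_le_succ_iff.1 hij), mul_sum]
      rw [sum_comm]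
      refine sum_congr rfl fun y _ => ?_
      rw [sum_comm]
      refine sum_congr rfl fun z _ => ?_
      rw [Fin.val_succ, Fin.val_succ, pow_succ', mul_apply, sum_mul, sum_mul, mul_sum,
        Nat.add_sub_add_right, Nat.add_sub_add_right]
      exact sum_congr rfl fun x _ => by ring

end WalkWeight

section PairsOfWalks

open Finset Matrix

variable {V : Type*} [Fintype V]

theorem sum_sum_sum_sum_comm (S : V → Finset V) (f : V → V → V → V → ℝ) :
    ∑ u, ∑ v, ∑ z, ∑ y ∈ S z, f u v z y = ∑ z, ∑ y ∈ S z, ∑ u, ∑ v, f u v z y := by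
  calc ∑ u, ∑ v, ∑ z, ∑ y ∈ S z, f u v z y
      = ∑ u, ∑ z, ∑ y ∈ S z, ∑ v, f u v z y := sum_congr rfl fun u _ =>
        sum_comm.trans (sum_congr rfl fun z _ => sum_comm)
    _ = ∑ z, ∑ y ∈ S z, ∑ u, ∑ v, f u v z y :=
        sum_comm.trans (sum_congr rfl fun z _ => sum_comm)

variable [DecidableEq V] {M : Matrix V V ℝ}

theorem isHermitian_sum_pow_mul_pow_mul_pow_mul_pow (hM : M.IsHermitian) (i j k l : ℕ) (z y : V) :
    ∑ u, ∑ v, ((M ^ i) u z * (M ^ j) z v) * ((M ^ k) u y * (M ^ l) y v)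
      = (M ^ (i + k)) z y * (M ^ (j + l)) z y := by
  rw [isHermitian_pow_add_apply hM i k, isHermitian_pow_add_apply hM j l, sum_mul_sum]
  refine sum_congr rfl fun u _ => sum_congr rfl fun v _ => ?_
  rw [isHermitian_pow_apply_comm hM j, isHermitian_pow_apply_comm hM l]
  ring

theorem sum_sum_pow_mul_sum_filter_eq (hM : M.IsHermitian) (r : V → V → Prop) [DecidableRel r]
    (i j k l : ℕ) :
    ∑ u, ∑ v, ∑ z, ((M ^ i) u z * (M ^ j) z v) * ∑ y with r z y, ((M ^ k) u y * (M ^ l) y v)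
      = ∑ z, ∑ y with r z y, (M ^ (i + k)) z y * (M ^ (j + l)) z y := by
  simp only [mul_sum]
  rw [sum_sum_sum_sum_comm (fun z => univ.filter (r z))]
  exact sum_congr rfl fun z _ => sum_congr rfl fun y _ =>
    isHermitian_sum_pow_mul_pow_mul_pow_mul_pow hM i j k l z y

theorem sum_sum_sum_pow_mul_pow_sq_eq (hM : M.IsHermitian) (i j : ℕ) :
    ∑ u, ∑ v, ∑ z, ((M ^ i) u z * (M ^ j) z v) ^ 2
      = ∑ z, (M ^ (2 * i)) z z * (M ^ (2 * j)) z z := by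
  simpa [← sq, ← two_mul, sum_filter] using sum_sum_pow_mul_sum_filter_eq hM Eq i j i j

variable [Nonempty V] {G : SimpleGraph V} [DecidableRel G.Adj] {s ℓ : ℕ} {δ N η c : ℝ}

open scoped Classical in
/-- Weighted Kővári–Sós–Turán for each pair of ends `u`, `v`; the errors it leaves add up to
collisions, which are rare by `sum_normalizedAdjMatrix_pow_mul_pow_le`. -/
theorem sum_sum_pow_mul_sum_eqOrAdj_le (hG : (completeBipartiteGraph (Fin s) (Fin s)).Free G)
    (hδ : 0 < δ) (hd : ∀ x, δ ≤ G.degree x) (hN : 0 < N) (hNV : N ^ ℓ = Fintype.card V)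
    (hη : 0 < η) (hc : 0 < c) (hsc : 4 * (s * c) ≤ η) (hmc : 4 * (s * c) ≤ (η / 4) ^ s * η)
    (hδc : 4 * N / δ ≤ η * c ^ 2) {i j k l : ℕ} (hi : i ≠ 0) (hj : j ≠ 0) (hk : k ≠ 0)
    (hl : l ≠ 0) (hij : i + j = ℓ) (hkl : k + l = ℓ) :
    ∑ u, ∑ v, ∑ z, ((normalizedAdjMatrix G ^ i) u z * (normalizedAdjMatrix G ^ j) z v) *
        ∑ y with EqOrAdj G z y,
          ((normalizedAdjMatrix G ^ k) u y * (normalizedAdjMatrix G ^ l) y v)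
      ≤ 2 * η * (normalizedAdjMatrix G ^ (2 * ℓ)).trace := by
  have hM := isHermitian_normalizedAdjMatrix G
  have hM0 := pow_apply_nonneg (normalizedAdjMatrix_nonneg G)
  have collisions {i j : ℕ} (hi : i ≠ 0) (hj : j ≠ 0) (hij : i + j = ℓ) :=
    sum_normalizedAdjMatrix_pow_mul_pow_le hδ hd hi hj hN (hij ▸ hNV)
  have free (Z Y : Finset V) := card_le_of_completeBipartiteGraph_free hG (Z := Z) (Y := Y)
  set M := normalizedAdjMatrix G
  set T := (M ^ (2 * ℓ)).trace with hT
  have hT0 : 0 ≤ T := sum_nonneg fun z _ => hM0 _ z z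
  calc ∑ u, ∑ v, ∑ z, ((M ^ i) u z * (M ^ j) z v) *
          ∑ y with EqOrAdj G z y, ((M ^ k) u y * (M ^ l) y v)
      ≤ ∑ u, ∑ v, (η * (M ^ ℓ) u v ^ 2 + (∑ z, ((M ^ i) u z * (M ^ j) z v) ^ 2 +
          ∑ y, ((M ^ k) u y * (M ^ l) y v) ^ 2) / c ^ 2) := by
        refine sum_le_sum fun u _ => sum_le_sum fun v _ => sum_mul_sum_filter_le_add free
          (fun z => mul_nonneg (hM0 _ _ _) (hM0 _ _ _))
          (fun y => mul_nonneg (hM0 _ _ _) (hM0 _ _ _)) ?_ ?_ hc hη hsc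
          (by push_cast; linarith)
        · rw [← mul_apply, ← pow_add, hij]
        · rw [← mul_apply, ← pow_add, hkl]
    _ = η * T + (∑ z, (M ^ (2 * i)) z z * (M ^ (2 * j)) z z +
          ∑ z, (M ^ (2 * k)) z z * (M ^ (2 * l)) z z) / c ^ 2 := by
        simp only [sum_add_distrib, ← mul_sum, ← sum_div, hT, isHermitian_trace_pow_two_mul hM,
          sum_sum_sum_pow_mul_pow_sq_eq hM]
    _ ≤ η * T + (2 * N / δ * T + 2 * N / δ * T) / c ^ 2 := by
        gcongr
        · exact (collisions hi hj hij).trans_eq (by rw [hij])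
        · exact (collisions hk hl hkl).trans_eq (by rw [hkl])
    _ = η * T + (4 * N / δ) / c ^ 2 * T := by ring
    _ ≤ η * T + η * T := by
        gcongr
        rwa [div_le_iff₀ (by positivity)]
    _ = 2 * η * T := by ring

open scoped Classical in
theorem sum_sum_eqOrAdj_pow_mul_pow_le (hG : (completeBipartiteGraph (Fin s) (Fin s)).Free G)
    (hδ : 0 < δ) (hd : ∀ x, δ ≤ G.degree x) (hN : 0 < N) (hNV : N ^ ℓ = Fintype.card V)
    (hη : 0 < η) (hc : 0 < c) (hsc : 4 * (s * c) ≤ η) (hmc : 4 * (s * c) ≤ (η / 4) ^ s * η)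
    (hδc : 4 * N / δ ≤ η * c ^ 2) {a b : ℕ} (ha : 2 ≤ a) (hb : 2 ≤ b) (hab : a + b = 2 * ℓ) :
    ∑ z, ∑ y with EqOrAdj G z y, (normalizedAdjMatrix G ^ a) z y * (normalizedAdjMatrix G ^ b) z y
      ≤ 2 * η * (normalizedAdjMatrix G ^ (2 * ℓ)).trace := by
  wlog hle : a ≤ b generalizing a b
  · simpa only [mul_comm] using this hb ha (by omega) (by omega)
  -- The left-hand side depends only on `a` and `b`, so the two vertices may be taken to be the
  -- first internal vertex of one walk and the `(a - 1)`-st vertex of the other.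
  have := sum_sum_pow_mul_sum_eqOrAdj_le hG hδ hd hN hNV hη hc hsc hmc hδc (i := 1) (j := ℓ - 1)
    (k := a - 1) (l := ℓ - (a - 1)) (by omega) (by omega) (by omega) (by omega) (by omega)
    (by omega)
  rwa [sum_sum_pow_mul_sum_filter_eq (isHermitian_normalizedAdjMatrix G),
    show 1 + (a - 1) = a by omega, show ℓ - 1 + (ℓ - (a - 1)) = b by omega] at this

end PairsOfWalks

section WalkPairWeight

open Finset Matrix

variable {V : Type*} [Fintype V] [DecidableEq V] {n : ℕ}

open scoped Classical in
/-- The total weight of the pairs `(p, q)` related by `R` of walks of length `n` with common ends,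
each pair being weighted by the product of the weights of its members. -/
noncomputable def walkPairWeight (M : Matrix V V ℝ) (n : ℕ)
    (R : (Fin (n + 1) → V) → (Fin (n + 1) → V) → Prop) : ℝ :=
  ∑ u, ∑ v, ∑ p, walkWeight M n u v p * ∑ q with R p q, walkWeight M n u v q

variable {M : Matrix V V ℝ} {R : (Fin (n + 1) → V) → (Fin (n + 1) → V) → Prop}

theorem walkPairWeight_flip : walkPairWeight M n (flip R) = walkPairWeight M n R := by
  classical
  exact sum_congr rfl fun u _ => sum_congr rfl fun v _ =>
    (sum_sum_filter_mul_comm R univ univ (walkWeight M n u v) (walkWeight M n u v)).symm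

theorem walkPairWeight_le_sum (hM : ∀ x y, 0 ≤ M x y) {ι : Type*} (S : Finset ι)
    {E : ι → (Fin (n + 1) → V) → (Fin (n + 1) → V) → Prop}
    (h : ∀ p q, R p q → ∃ i ∈ S, E i p q) :
    walkPairWeight M n R ≤ ∑ i ∈ S, walkPairWeight M n (E i) := by
  classical
  have hw := walkWeight_nonneg hM n
  have swap : ∑ i ∈ S, walkPairWeight M n (E i) = ∑ u, ∑ v, ∑ p,
      walkWeight M n u v p * ∑ i ∈ S, ∑ q with E i p q, walkWeight M n u v q := by
    simp only [walkPairWeight, mul_sum (s := S)]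
    rw [sum_comm]
    refine sum_congr rfl fun u _ => ?_
    rw [sum_comm]
    exact sum_congr rfl fun v _ => sum_comm
  rw [swap]
  refine sum_le_sum fun u _ => sum_le_sum fun v _ => sum_le_sum fun p _ =>
    mul_le_mul_of_nonneg_left ?_ (hw u v p)
  simp only [sum_filter]
  rw [sum_comm]
  refine sum_le_sum fun q _ => ?_
  have hnonneg (i) : 0 ≤ if E i p q then walkWeight M n u v q else 0 := by
    split_ifs <;> simp only [hw, le_refl]
  split_ifs with hR
  · obtain ⟨i, hi, hE⟩ := h p q hR
    exact (if_pos hE).symm.le.trans (single_le_sum (fun i _ => hnonneg i) hi)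
  · exact sum_nonneg fun i _ => hnonneg i

theorem walkPairWeight_or_le (hM : ∀ x y, 0 ≤ M x y)
    (R₁ R₂ : (Fin (n + 1) → V) → (Fin (n + 1) → V) → Prop) :
    walkPairWeight M n (fun p q => R₁ p q ∨ R₂ p q)
      ≤ walkPairWeight M n R₁ + walkPairWeight M n R₂ := by
  refine (walkPairWeight_le_sum hM univ (E := fun b : Bool => if b then R₁ else R₂) ?_).trans_eq
    (by simp)
  rintro p q (h | h)
  exacts [⟨true, mem_univ _, h⟩, ⟨false, mem_univ _, h⟩]

theorem walkPairWeight_exists_exists_le (hM : ∀ x y, 0 ≤ M x y) {κ : ℝ} (hκ : 0 ≤ κ)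
    {P : Fin (n + 1) → Fin (n + 1) → Prop}
    {E : Fin (n + 1) → Fin (n + 1) → (Fin (n + 1) → V) → (Fin (n + 1) → V) → Prop}
    (hE : ∀ i j, P i j → walkPairWeight M n (E i j) ≤ κ) :
    walkPairWeight M n (fun p q => ∃ i j, P i j ∧ E i j p q) ≤ (n + 1) ^ 2 * κ := by
  classical
  calc walkPairWeight M n (fun p q => ∃ i j, P i j ∧ E i j p q)
      ≤ ∑ x : Fin (n + 1) × Fin (n + 1) with P x.1 x.2, walkPairWeight M n (E x.1 x.2) :=
        walkPairWeight_le_sum hM _ fun p q ⟨i, j, hP, h⟩ => ⟨(i, j), by simpa using hP, h⟩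
    _ ≤ #{x : Fin (n + 1) × Fin (n + 1) | P x.1 x.2} • κ :=
        sum_le_card_nsmul _ _ _ fun x hx => hE _ _ (mem_filter.1 hx).2
    _ ≤ Fintype.card (Fin (n + 1) × Fin (n + 1)) • κ :=
        nsmul_le_nsmul_left hκ (card_filter_le _ _)
    _ = (n + 1) ^ 2 * κ := by simp [sq]

open scoped Classical in
theorem walkPairWeight_apply_apply (hM : M.IsHermitian) (r : V → V → Prop) (i j : Fin (n + 1)) :
    walkPairWeight M n (fun p q => r (p i) (q j))
      = ∑ z, ∑ y with r z y,
          (M ^ (i + j : ℕ)) z y * (M ^ ((n - i) + (n - j) : ℕ)) z y := by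
  have right_marginal (u v z : V) : ∑ q with r z (q j), walkWeight M n u v q
      = ∑ y with r z y, (M ^ (j : ℕ)) u y * (M ^ (n - j : ℕ)) y v := by
    simpa [sum_filter] using sum_walkWeight_mul_apply M n u v j fun y => if r z y then 1 else 0
  rw [← sum_sum_pow_mul_sum_filter_eq hM]
  refine sum_congr rfl fun u _ => sum_congr rfl fun v _ => ?_
  simp only [right_marginal]
  rw [sum_walkWeight_mul_apply M n u v i fun z =>
    ∑ y with r z y, (M ^ (j : ℕ)) u y * (M ^ (n - j : ℕ)) y v]
  simp only [mul_comm]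

open scoped Classical in
theorem walkPairWeight_left_apply_apply (hM : M.IsHermitian) (r : V → V → Prop)
    {i j : Fin (n + 1)} (hij : i ≤ j) :
    walkPairWeight M n (fun p _ => r (p i) (p j))
      = ∑ y, ∑ z with r y z,
          (M ^ (j - i : ℕ)) y z * (M ^ ((i + n) + (n - j) : ℕ)) y z := by
  have left_marginal (u v : V) :
      ∑ p, walkWeight M n u v p * ∑ q with r (p i) (p j), walkWeight M n u v q
        = ∑ y, ∑ z with r y z, (M ^ (j - i : ℕ)) y z *
            (((M ^ (i : ℕ)) u y * (M ^ n) u v) * (M ^ (n - j : ℕ)) z v) := by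
    have := sum_walkWeight_mul_apply_apply M n u v hij fun y z => if r y z then (M ^ n) u v else 0
    simp only [ite_mul, zero_mul, ← sum_filter] at this
    refine Eq.trans (sum_congr rfl fun p _ => ?_) (this.trans ?_)
    · split_ifs with h <;> simp [h, sum_walkWeight]
    · exact sum_congr rfl fun y _ => sum_congr rfl fun z _ => by ring
  have closed_walk (y z : V) :
      ∑ u, ∑ v, ((M ^ (i : ℕ)) u y * (M ^ n) u v) * (M ^ (n - j : ℕ)) z v
        = (M ^ ((i + n) + (n - j) : ℕ)) y z := by
    rw [isHermitian_pow_apply_comm hM _ y z, add_comm _ (n - j), pow_add, mul_apply, sum_comm]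
    refine sum_congr rfl fun v _ => ?_
    rw [isHermitian_pow_apply_comm hM _ v y, isHermitian_pow_add_apply hM, ← sum_mul, mul_comm]
  calc walkPairWeight M n (fun p _ => r (p i) (p j))
      = ∑ u, ∑ v, ∑ y, ∑ z with r y z, (M ^ (j - i : ℕ)) y z *
          (((M ^ (i : ℕ)) u y * (M ^ n) u v) * (M ^ (n - j : ℕ)) z v) :=
        sum_congr rfl fun u _ => sum_congr rfl fun v _ => left_marginal u v
    _ = _ := by
        rw [sum_sum_sum_sum_comm fun y => univ.filter (r y)]
        simp only [← mul_sum, closed_walk]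

end WalkPairWeight

section Conflicts

open Finset Matrix

variable {V : Type*} {n : ℕ}

/-- No two vertices of `p` that are at least two steps apart coincide or are adjacent: a walk with
this property is an induced path. -/
def IsChordless (G : SimpleGraph V) (p : Fin (n + 1) → V) : Prop :=
  ∀ i j : Fin (n + 1), (i + 2 : ℕ) ≤ j → ¬EqOrAdj G (p i) (p j)

/-- No internal vertex of `p` coincides with or is adjacent to an internal vertex of `q`. -/
def InternallySeparated (G : SimpleGraph V) (p q : Fin (n + 1) → V) : Prop :=
  ∀ i j : Fin (n + 1), (i ≠ 0 ∧ i ≠ Fin.last n) ∧ (j ≠ 0 ∧ j ≠ Fin.last n) →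
    ¬EqOrAdj G (p i) (q j)

/-- Failure of the conditions under which two walks with common ends may serve as two of the paths
of an induced theta graph. -/
def WalkConflict (G : SimpleGraph V) (p q : Fin (n + 1) → V) : Prop :=
  (¬IsChordless G p ∨ ¬IsChordless G q) ∨ ¬InternallySeparated G p q

theorem InternallySeparated.symm {G : SimpleGraph V} {p q : Fin (n + 1) → V}
    (h : InternallySeparated G p q) : InternallySeparated G q p :=
  fun i j hij hc => h j i hij.symm hc.symm

instance (G : SimpleGraph V) : Std.Symm (WalkConflict (n := n) G) where
  symm _ _ := Or.imp Or.symm fun h hqp => h hqp.symm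

variable [Fintype V] [DecidableEq V] {M : Matrix V V ℝ}

open scoped Classical in
theorem walkPairWeight_walkConflict_le (hM : M.IsHermitian) (hM0 : ∀ x y, 0 ≤ M x y)
    (G : SimpleGraph V) (hn : 2 ≤ n) {κ : ℝ}
    (hκ : ∀ a b, 2 ≤ a → 2 ≤ b → a + b = 2 * n →
      ∑ z, ∑ y with EqOrAdj G z y, (M ^ a) z y * (M ^ b) z y ≤ κ) :
    walkPairWeight M n (WalkConflict G) ≤ 3 * ((n + 1) ^ 2 * κ) := by
  have hκ0 : 0 ≤ κ := (sum_nonneg fun z _ => sum_nonneg fun y _ =>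
    mul_nonneg (pow_apply_nonneg hM0 _ _ _) (pow_apply_nonneg hM0 _ _ _)).trans
      (hκ n n hn hn (two_mul n).symm)
  have left_chord : walkPairWeight M n (fun p _ => ¬IsChordless G p) ≤ (n + 1) ^ 2 * κ := by
    simp only [IsChordless, not_forall, not_not, exists_prop]
    refine walkPairWeight_exists_exists_le hM0 hκ0 fun i j hij => ?_
    rw [walkPairWeight_left_apply_apply hM _ (by omega)]
    exact hκ _ _ (by omega) (by omega) (by omega)
  have right_chord : walkPairWeight M n (fun _ q => ¬IsChordless G q) ≤ (n + 1) ^ 2 * κ :=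
    walkPairWeight_flip.trans_le left_chord
  have cross : walkPairWeight M n (fun p q => ¬InternallySeparated G p q) ≤ (n + 1) ^ 2 * κ := by
    simp only [InternallySeparated, not_forall, not_not, exists_prop]
    refine walkPairWeight_exists_exists_le hM0 hκ0 fun i j ⟨⟨hi₀, hi⟩, hj₀, hj⟩ => ?_
    rw [walkPairWeight_apply_apply hM]
    rw [ne_eq, Fin.ext_iff, Fin.val_last] at hi hj
    rw [ne_eq, Fin.ext_iff, Fin.val_zero] at hi₀ hj₀
    exact hκ _ _ (by omega) (by omega) (by omega)
  calc walkPairWeight M n (WalkConflict G)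
      ≤ walkPairWeight M n (fun p q => ¬IsChordless G p ∨ ¬IsChordless G q) +
          walkPairWeight M n (fun p q => ¬InternallySeparated G p q) :=
        walkPairWeight_or_le hM0 _ _
    _ ≤ (walkPairWeight M n (fun p _ => ¬IsChordless G p) +
          walkPairWeight M n (fun _ q => ¬IsChordless G q)) +
          walkPairWeight M n (fun p q => ¬InternallySeparated G p q) :=
        add_le_add_left (walkPairWeight_or_le hM0 _ _) _
    _ ≤ 3 * ((n + 1) ^ 2 * κ) := by linarith

end Conflicts

section ThetaAssembly

theorem fromRel_isIndContained {A V : Type*} {r : A → A → Prop} {G : SimpleGraph V} {f : A → V}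
    (hr : ∀ x y, r x y → G.Adj (f x) (f y))
    (hnr : ∀ x y, x ≠ y → ¬r x y → ¬r y x → ¬EqOrAdj G (f x) (f y)) :
    (SimpleGraph.fromRel r).IsIndContained G := by
  have adj_of {x y} (h : r x y ∨ r y x) : G.Adj (f x) (f y) :=
    h.elim (hr x y) fun h => (hr y x h).symm
  have rel_of {x y} (hxy : x ≠ y) (h : EqOrAdj G (f x) (f y)) : r x y ∨ r y x := by
    by_contra! hc
    exact hnr x y hxy hc.1 hc.2 h
  have f_injective : Function.Injective f := fun x y h => by
    by_contra hxy
    exact (adj_of (rel_of hxy (Or.inl h))).ne h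
  refine ⟨⟨⟨f, f_injective⟩, fun {x y} => ?_⟩⟩
  rw [SimpleGraph.fromRel_adj]
  exact ⟨fun h => ⟨fun hxy => h.ne (congrArg f hxy),
    rel_of (fun hxy => h.ne (congrArg f hxy)) (Or.inr h)⟩, fun h => adj_of h.2⟩

variable {V : Type*} {G : SimpleGraph V} {ℓ t : ℕ} {u v : V} {P : Fin t → Fin (ℓ + 1) → V}

/-- The map from the theta graph that sends its `i`-th path to the walk `P i`, where all these walks
start at `u` and end at `v`. -/
def thetaMap (u v : V) (P : Fin t → Fin (ℓ + 1) → V) : ThetaVertex ℓ t → V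
  | .inl false => u
  | .inl true => v
  | .inr (i, j) => P i ⟨j + 1, by omega⟩

theorem adj_thetaMap_of_thetaStep (hu : ∀ i, P i 0 = u) (hv : ∀ i, P i (Fin.last ℓ) = v)
    (hP : ∀ i (k : Fin ℓ), G.Adj (P i k.castSucc) (P i k.succ)) :
    ∀ x y, ThetaStep ℓ t x y → G.Adj (thetaMap u v P x) (thetaMap u v P y) := by
  have adj_of_succ (i) {k k' : Fin (ℓ + 1)} (h : (k + 1 : ℕ) = k') : G.Adj (P i k) (P i k') := by
    have hk' : k' = Fin.succ ⟨k, by omega⟩ := Fin.ext h.symm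
    exact hk' ▸ hP i ⟨k, _⟩
  rintro ((_ | _) | ⟨i, j⟩) ((_ | _) | ⟨i', j'⟩) h
  case inl.false.inr => exact hu i' ▸ adj_of_succ i' (congrArg (· + 1) h.symm)
  case inr.inl.true => exact hv i ▸ adj_of_succ i h
  case inr.inr =>
    obtain ⟨rfl, h⟩ := h
    exact adj_of_succ i (congrArg (· + 1) h)
  all_goals exact h.elim

theorem not_eqOrAdj_thetaMap (hℓ : 2 ≤ ℓ) (ht : 2 ≤ t) (hu : ∀ i, P i 0 = u)
    (hv : ∀ i, P i (Fin.last ℓ) = v) (hP : Pairwise fun i j => ¬WalkConflict G (P i) (P j)) :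
    ∀ x y, x ≠ y → ¬ThetaStep ℓ t x y → ¬ThetaStep ℓ t y x →
      ¬EqOrAdj G (thetaMap u v P x) (thetaMap u v P y) := by
  have : Nontrivial (Fin t) := Fin.nontrivial_iff_two_le.2 ht
  have chordless (i) : IsChordless G (P i) := by
    obtain ⟨j, hj⟩ := exists_ne i
    exact not_not.1 fun h => hP hj (Or.inl (Or.inr h))
  have separated {i j} (hij : i ≠ j) : InternallySeparated G (P i) (P j) :=
    not_not.1 fun h => hP hij (Or.inr h)
  have ends : ¬EqOrAdj G u v := by
    have i : Fin t := ⟨0, by omega⟩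
    exact hu i ▸ hv i ▸ chordless i 0 (Fin.last ℓ) (by simpa using hℓ)
  have start (i : Fin t) (j : Fin (ℓ - 1)) (hj : (j : ℕ) ≠ 0) :
      ¬EqOrAdj G u (thetaMap u v P (.inr (i, j))) :=
    hu i ▸ chordless i 0 ⟨j + 1, _⟩ (by rw [Fin.val_zero, Fin.val_mk]; omega)
  have finish (i : Fin t) (j : Fin (ℓ - 1)) (hj : (j : ℕ) + 2 ≠ ℓ) :
      ¬EqOrAdj G (thetaMap u v P (.inr (i, j))) v :=
    hv i ▸ chordless i ⟨j + 1, _⟩ (Fin.last ℓ) (by rw [Fin.val_last, Fin.val_mk]; omega)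
  rintro ((_ | _) | ⟨i, j⟩) ((_ | _) | ⟨i', j'⟩) hne hxy hyx
  · exact absurd rfl hne
  · exact ends
  · exact start i' j' hxy
  · exact fun h => ends h.symm
  · exact absurd rfl hne
  · exact fun h => finish i' j' hyx h.symm
  · exact fun h => start i j hyx h.symm
  · exact finish i j hxy
  · obtain rfl | hi := eq_or_ne i i'
    · have hjj' : (j : ℕ) ≠ j' := fun h => hne (by rw [Fin.ext h])
      have hj : (j : ℕ) + 1 ≠ j' := fun h => hxy ⟨rfl, h⟩
      have hj' : (j' : ℕ) + 1 ≠ j := fun h => hyx ⟨rfl, h⟩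
      rcases lt_or_gt_of_ne hjj' with h | h
      · exact chordless i ⟨j + 1, _⟩ ⟨j' + 1, _⟩ (by simp only; omega)
      · exact fun hc => chordless i ⟨j' + 1, _⟩ ⟨j + 1, _⟩ (by simp only; omega) hc.symm
    · refine separated hi ⟨j + 1, _⟩ ⟨j' + 1, _⟩ ?_
      simp only [ne_eq, Fin.ext_iff, Fin.val_zero, Fin.val_last]
      omega

theorem thetaGraph_isIndContained_of_pairwise_not_walkConflict (hℓ : 2 ≤ ℓ) (ht : 2 ≤ t)
    (hu : ∀ i, P i 0 = u) (hv : ∀ i, P i (Fin.last ℓ) = v)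
    (hadj : ∀ i (k : Fin ℓ), G.Adj (P i k.castSucc) (P i k.succ))
    (hP : Pairwise fun i j => ¬WalkConflict G (P i) (P j)) :
    (thetaGraph ℓ t).IsIndContained G :=
  fromRel_isIndContained (adj_thetaMap_of_thetaStep hu hv hadj)
    (not_eqOrAdj_thetaMap hℓ ht hu hv hP)

end ThetaAssembly

section MinimumDegree

open Finset SimpleGraph

theorem lt_card_edgeFinset_induce_compl_singleton {V : Type*} [Fintype V] [DecidableEq V]
    (G : SimpleGraph V) [DecidableRel G.Adj] {δ : ℝ} (hG : δ * Fintype.card V ≤ #G.edgeFinset)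
    {x : V} (hx : G.degree x < δ) :
    δ * Fintype.card ({x}ᶜ : Set V) < #(G.induce {x}ᶜ).edgeFinset := by
  have hcard : (Fintype.card ({x}ᶜ : Set V) : ℝ) = Fintype.card V - 1 := by
    rw [Fintype.card_compl_set, Set.card_singleton,
      Nat.cast_sub (Fintype.card_pos_iff.2 ⟨x⟩), Nat.cast_one]
  rw [card_edgeFinset_induce_compl_singleton, card_edgeFinset_deleteIncidenceSet,
    Nat.cast_sub (G.degree_le_card_edgeFinset x), hcard]
  linarith

theorem exists_isIndContained_le_degree.{u} {V : Type u} [Fintype V] [Nonempty V]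
    (G : SimpleGraph V) [DecidableRel G.Adj] {δ : ℝ} (hG : δ * Fintype.card V ≤ #G.edgeFinset) :
    ∃ (W : Type u) (_ : Fintype W) (_ : Nonempty W) (H : SimpleGraph W) (_ : DecidableRel H.Adj),
      H.IsIndContained G ∧ ∀ x, δ ≤ H.degree x := by
  classical
  induction hn : Fintype.card V using Nat.strong_induction_on generalizing V with
  | _ n ih =>
    by_cases! hδ : ∀ x, δ ≤ G.degree x
    · exact ⟨V, _, ‹_›, G, _, .refl G, hδ⟩
    obtain ⟨x, hx⟩ := hδ
    have hδ0 : 0 < δ := (Nat.cast_nonneg _).trans_lt hx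
    have hGx := lt_card_edgeFinset_induce_compl_singleton G hG hx
    obtain ⟨e, -⟩ : (G.induce {x}ᶜ).edgeFinset.Nonempty :=
      card_pos.1 (Nat.cast_pos.1 (lt_of_le_of_lt (by positivity) hGx))
    have : Nonempty ({x}ᶜ : Set V) := ⟨e.out.1⟩
    obtain ⟨W, hW, hW', H, hH, hHG, hd⟩ := ih _
      (hn ▸ Fintype.card_subtype_lt (x := x) (by simp)) (G.induce {x}ᶜ) hGx.le rfl
    exact ⟨W, hW, hW', H, hH, hHG.trans ⟨Embedding.induce _⟩, hd⟩

end MinimumDegree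

section WalkExtraction

open Finset Matrix

variable {V : Type*} [Fintype V] [DecidableEq V] {G : SimpleGraph V} [DecidableRel G.Adj]

theorem walkWeight_normalizedAdjMatrix_pos_imp {n : ℕ} {u v : V} {p : Fin (n + 1) → V}
    (hp : 0 < walkWeight (normalizedAdjMatrix G) n u v p) :
    p 0 = u ∧ p (Fin.last n) = v ∧ ∀ k : Fin n, G.Adj (p k.castSucc) (p k.succ) := by
  unfold walkWeight at hp
  split_ifs at hp with ends
  · exact ⟨ends.1, ends.2, fun k =>
      adj_of_normalizedAdjMatrix_ne_zero (prod_ne_zero_iff.1 hp.ne' k (mem_univ k))⟩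
  · exact absurd hp (lt_irrefl 0)

theorem thetaGraph_isIndContained_of_walkPairWeight_lt {ℓ t : ℕ} (hℓ : 2 ≤ ℓ) (ht : 2 ≤ t)
    (h : 4 * t * walkPairWeight (normalizedAdjMatrix G) ℓ (WalkConflict G)
      < (normalizedAdjMatrix G ^ (2 * ℓ)).trace) :
    (thetaGraph ℓ t).IsIndContained G := by
  classical
  rw [isHermitian_trace_pow_two_mul (isHermitian_normalizedAdjMatrix G), walkPairWeight,
    mul_sum] at h
  obtain ⟨u, -, hu⟩ := exists_lt_of_sum_lt h
  rw [mul_sum] at hu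
  obtain ⟨v, -, huv⟩ := exists_lt_of_sum_lt hu
  obtain ⟨P, hP, hconflict⟩ := exists_pairwise_not_conflict
    (walkWeight_nonneg (normalizedAdjMatrix_nonneg G) ℓ u v)
    (sum_walkWeight (normalizedAdjMatrix G) ℓ u v) (by omega) huv
  have hwalk (a) := walkWeight_normalizedAdjMatrix_pos_imp (hP a)
  exact thetaGraph_isIndContained_of_pairwise_not_walkConflict hℓ ht (fun a => (hwalk a).1)
    (fun a => (hwalk a).2.1) (fun a => (hwalk a).2.2) hconflict

end WalkExtraction

section Constants

theorem cast_mul_pow_le_one {x : ℝ} (hx : 0 ≤ x) (hx4 : 4 * x ≤ 1) (s : ℕ) : s * x ^ s ≤ 1 := by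
  calc s * x ^ s ≤ 2 ^ s * (1 / 2) ^ s := by
        gcongr
        · exact_mod_cast Nat.lt_two_pow_self.le
        · linarith
    _ = 1 := by rw [← mul_pow]; norm_num

theorem four_mul_cast_mul_pow_le {x : ℝ} (hx : 0 ≤ x) (hx4 : 4 * x ≤ 1) (s : ℕ) :
    4 * (s * x ^ (7 * s + 6)) ≤ (x ^ 5 / 4) ^ s * x ^ 5 := by
  have hx6 : x ^ 6 ≤ x ^ 5 / 4 := by
    linarith [mul_le_mul_of_nonneg_right hx4 (pow_nonneg hx 5), show x * x ^ 5 = x ^ 6 by ring]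
  calc 4 * (s * x ^ (7 * s + 6)) = (4 * x) * (s * x ^ s) * ((x ^ 6) ^ s * x ^ 5) := by ring
    _ ≤ 1 * 1 * ((x ^ 5 / 4) ^ s * x ^ 5) := by
        gcongr
        exact cast_mul_pow_le_one hx hx4 s
    _ = (x ^ 5 / 4) ^ s * x ^ 5 := by ring

theorem four_mul_pow_le {x : ℝ} (hx : 0 ≤ x) (hx4 : 4 * x ≤ 1) {s : ℕ} (hs : 0 < s) :
    4 * x ^ (20 * s + 16) ≤ x ^ 5 * (x ^ (7 * s + 6)) ^ 2 := by
  calc 4 * x ^ (20 * s + 16) = 4 * x * x ^ (20 * s + 15) := by ring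
    _ ≤ 1 * x ^ (5 + (7 * s + 6) * 2) :=
        mul_le_mul hx4 (pow_le_pow_of_le_one hx (by linarith) (by omega)) (by positivity)
          zero_le_one
    _ = x ^ 5 * (x ^ (7 * s + 6)) ^ 2 := by ring

theorem twentyFour_mul_mul_succ_sq_lt_pow {ℓ t : ℕ} (hℓ : 2 ≤ ℓ) (ht : 2 ≤ t) :
    24 * t * (ℓ + 1) ^ 2 < (ℓ * t) ^ 5 := by
  have hsq : 4 * (ℓ + 1) ^ 2 ≤ 9 * ℓ ^ 2 := by nlinarith
  have hpow : 2 ^ 3 * 2 ^ 4 ≤ ℓ ^ 3 * t ^ 4 :=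
    Nat.mul_le_mul (Nat.pow_le_pow_left hℓ 3) (Nat.pow_le_pow_left ht 4)
  calc 24 * t * (ℓ + 1) ^ 2 = 6 * t * (4 * (ℓ + 1) ^ 2) := by ring
    _ ≤ 6 * t * (9 * ℓ ^ 2) := Nat.mul_le_mul_left _ hsq
    _ = 54 * (ℓ ^ 2 * t) := by ring
    _ < (ℓ ^ 3 * t ^ 4) * (ℓ ^ 2 * t) :=
        Nat.mul_lt_mul_of_pos_right (by omega) (by positivity)
    _ = (ℓ * t) ^ 5 := by ring

end Constants

section InducedTheta

open Finset Matrix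

variable {V : Type*} [Fintype V] [Nonempty V] {G : SimpleGraph V} [DecidableRel G.Adj] {s ℓ t : ℕ}

theorem four_mul_walkPairWeight_walkConflict_lt [DecidableEq V] (hℓ : 2 ≤ ℓ) (ht : 2 ≤ t)
    (hs : 0 < s) (hG : (completeBipartiteGraph (Fin s) (Fin s)).Free G) {N : ℝ} (hN : 0 < N)
    (hNV : N ^ ℓ = Fintype.card V) (hd : ∀ x, (ℓ * t : ℝ) ^ (20 * s + 16) * N ≤ G.degree x) :
    4 * t * walkPairWeight (normalizedAdjMatrix G) ℓ (WalkConflict G)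
      < (normalizedAdjMatrix G ^ (2 * ℓ)).trace := by
  have hq4 : (4 : ℝ) ≤ ℓ * t := by exact_mod_cast Nat.mul_le_mul hℓ ht
  have hq : (0 : ℝ) < ℓ * t := by linarith
  obtain ⟨x, hxq⟩ : ∃ x : ℝ, x = (ℓ * t : ℝ)⁻¹ := ⟨_, rfl⟩
  have hx : 0 < x := hxq ▸ inv_pos.2 hq
  have hx4 : 4 * x ≤ 1 := by rwa [hxq, ← div_eq_mul_inv, div_le_one hq]
  have hδ : 0 < (ℓ * t : ℝ) ^ (20 * s + 16) * N := by positivity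
  have hT := one_le_trace_normalizedAdjMatrix_pow G
    (fun y => Nat.cast_pos.1 (hδ.trans_le (hd y))) ℓ
  have hmc := four_mul_cast_mul_pow_le hx.le hx4 s
  have hsc : 4 * (s * x ^ (7 * s + 6)) ≤ x ^ 5 := hmc.trans <|
    mul_le_of_le_one_left (by positivity) (pow_le_one₀ (by positivity)
      (by linarith [pow_le_one₀ (n := 5) hx.le (by linarith)]))
  have hδc : 4 * N / ((ℓ * t : ℝ) ^ (20 * s + 16) * N) ≤ x ^ 5 * (x ^ (7 * s + 6)) ^ 2 := by
    rw [mul_div_mul_right _ _ hN.ne', div_eq_mul_inv, ← inv_pow, ← hxq]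
    exact four_mul_pow_le hx.le hx4 hs
  have hconflict := walkPairWeight_walkConflict_le (isHermitian_normalizedAdjMatrix G)
    (normalizedAdjMatrix_nonneg G) G hℓ fun a b =>
      sum_sum_eqOrAdj_pow_mul_pow_le hG hδ hd hN hNV (pow_pos hx 5) (pow_pos hx (7 * s + 6))
        hsc hmc hδc
  have hbudget : 24 * t * (ℓ + 1) ^ 2 * x ^ 5 < 1 := by
    rw [hxq, inv_pow, ← div_eq_mul_inv, div_lt_one (by positivity)]
    exact_mod_cast twentyFour_mul_mul_succ_sq_lt_pow hℓ ht
  set T := (normalizedAdjMatrix G ^ (2 * ℓ)).trace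
  calc 4 * t * walkPairWeight (normalizedAdjMatrix G) ℓ (WalkConflict G)
      ≤ 4 * t * (3 * ((ℓ + 1) ^ 2 * (2 * x ^ 5 * T))) := by gcongr
    _ = 24 * t * (ℓ + 1) ^ 2 * x ^ 5 * T := by ring
    _ < T := mul_lt_of_lt_one_left (by linarith) hbudget

theorem thetaGraph_isIndContained_of_le_degree (hℓ : 2 ≤ ℓ) (ht : 2 ≤ t) (hs : 0 < s)
    (hG : (completeBipartiteGraph (Fin s) (Fin s)).Free G)
    (hd : ∀ x, (ℓ * t : ℝ) ^ (20 * s + 16) * (Fintype.card V : ℝ) ^ (1 / (ℓ : ℝ)) ≤ G.degree x) :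
    (thetaGraph ℓ t).IsIndContained G := by
  classical
  have hV : (0 : ℝ) < Fintype.card V := Nat.cast_pos.2 Fintype.card_pos
  refine thetaGraph_isIndContained_of_walkPairWeight_lt hℓ ht
    (four_mul_walkPairWeight_walkConflict_lt hℓ ht hs hG (Real.rpow_pos_of_pos hV _) ?_ hd)
  rw [one_div, Real.rpow_inv_natCast_pow hV.le (by omega)]

end InducedTheta

theorem mainTheorem6 (ℓ t : ℕ) (hℓ : 2 ≤ ℓ) (ht : 2 ≤ t) :
    ∃ C : ℝ, 0 < C ∧
      ∀ s : ℕ, 2 ≤ s →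
        ∀ (V : Type*) [Fintype V] [Nonempty V] (G : SimpleGraph V) [DecidableRel G.Adj],
          (completeBipartiteGraph (Fin s) (Fin s)).Free G →
          C * ((ℓ : ℝ) * (t : ℝ)) ^ (20 * s) * (Fintype.card V : ℝ) ^ (1 + 1 / (ℓ : ℝ))
            ≤ (G.edgeFinset.card : ℝ) →
          (thetaGraph ℓ t).IsIndContained G := by
  refine ⟨((ℓ : ℝ) * t) ^ 16, by positivity, fun s hs V _ _ G _ hG hedges => ?_⟩
  have hV : (0 : ℝ) < Fintype.card V := Nat.cast_pos.2 Fintype.card_pos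
  obtain ⟨W, _, _, H, _, hHG, hd⟩ := exists_isIndContained_le_degree G
    (δ := (ℓ * t : ℝ) ^ (20 * s + 16) * (Fintype.card V : ℝ) ^ (1 / (ℓ : ℝ))) <| by
      rw [Real.rpow_add hV, Real.rpow_one] at hedges
      exact hedges.trans_eq' (by ring)
  have hWV : Fintype.card W ≤ Fintype.card V :=
    Fintype.card_le_of_embedding hHG.some.toEmbedding
  refine (thetaGraph_isIndContained_of_le_degree hℓ ht (by omega)
    (fun h => hG (h.trans hHG.isContained)) fun x => ?_).trans hHG
  refine le_trans ?_ (hd x)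
  gcongr
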